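/- Let $(\Omega,\mathcal F,\mathbb P)$ be a non-atomic probability space. Random variables are identified when they agree a.s., and $X\sim Y$ means that $X$ and $Y$ have the same distribution; $X$ is supported in $A\in\mathcal F$ if $X=0$ a.s. on $\Omega\setminus A$. Let $\mathcal X$ be a rearrangement-invariant (r.i.) space over $(\Omega,\mathcal F,\mathbb P)$, i.e. a nonzero Banach space of random variables such that for every $X\in\mathcal X$: if $Y$ is a random variable with $|Y|\le|X|$ a.s., then $Y\in\mathcal X$ and $\|Y\|\le\|X\|$; and if $Z$ is a random variable with $Z\sim X$, then $Z\in\mathcal X$ and $\|Z\|=\|X\|$. Assume that $\mathcal X\neq L^\infty$ (as sets of random variables). Put $\mathcal X_+=\{X\in\mathcal X: X\ge 0 \text{ a.s.}\}$ and let $$\mathcal X_a=\Big\{X\in\mathcal X:\ \lim_{\mathbb P(A)\to0}\|X\mathbf 1_A\|=0\Big\}$$ be the order continuous part of $\mathcal X$. For $X\in\mathcal X$ let $\mathcal{CL}(X)=\mathrm{co}\{Y: Y\sim X\}$ be the convex hull of the set of random variables with the same distribution as $X$, and for $\mathcal A,\mathcal B\subset\mathcal X$ let $\mathrm d(\mathcal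 A,\mathcal B)=\inf_{X\in\mathcal A,\,Y\in\mathcal B}\|X-Y\|$. For measurable sets $(A_n)_{n=1}^\infty$, write $A_n\downarrow\emptyset$ if $A_n\supseteq A_{n+1}$ for all $n$ and $\bigcap_n A_n=\emptyset$. The following statements are equivalent: 1. $\mathcal X$ has the Almost Order Continuous Equidistributional Average (AOCEA) property: $\mathrm d(\mathcal{CL}(X),\mathcal X_a)=0$ for every $X\in\mathcal X_+$. 2. For every $A\in\mathcal F$ with $\mathbb P(A)>0$, every $X\in\mathcal X$ supported in $A$, and every $\varepsilon>0$, there exist random variables $X_1,\dots,X_k$, all supported in $A$, with $X_i\sim X$ for $i=1,\dots,k$, a convex combination $\sum_{i=1}^k\lambda_iX_i$, and $V\in\mathcal X_a$, also supported in $A$, such that $$\Big\|\sum_{i=1}^k\lambda_iX_i-V\Big\|<\varepsilon.$$ 3. For every $X\in\mathcal X_+$, every sequence of measurable sets $(A_n)_{n=1}^\infty$ with $A_n\downarrow\emptyset$, and every $\varepsilon>0$, there exist $n_1,\dots,n_k\in\mathbb N$, random variables $Z_1,\dots,Z_k$ with $Z_i\sim X\mathbf 1_{A_{n_i}}$ for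 $i=1,\dots,k$, and a convex combination $Z=\sum_{i=1}^k\lambda_iZ_i$ such that $\|Z\|<\varepsilon$. 4. For every $X\in\mathcal X$, every $A\in\mathcal F$ with $\mathbb P(A)>0$, every sequence of measurable sets $(A_n)_{n=1}^\infty$ with $A_n\downarrow\emptyset$, and every $\varepsilon>0$, there exist $n_1,\dots,n_k\in\mathbb N$, random variables $Z_1,\dots,Z_k$, all supported in $A$, with $Z_i\sim X\mathbf 1_{A_{n_i}}$ for $i=1,\dots,k$, and a convex combination $Z=\sum_{i=1}^k\lambda_iZ_i$ such that $\|Z\|<\varepsilon$. -/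

import Mathlib

open MeasureTheory ProbabilityTheory
open scoped ENNReal

/-- A measure is non-atomic if every measurable set of positive measure has a measurable subset
of strictly smaller positive measure. -/
def IsNonatomic {Ω : Type*} [MeasurableSpace Ω] (P : Measure Ω) : Prop :=
  ∀ A : Set Ω, MeasurableSet A → 0 < P A →
    ∃ B : Set Ω, B ⊆ A ∧ MeasurableSet B ∧ 0 < P B ∧ P B < P A

/-- A rearrangement-invariant (r.i.) space over `(Ω, P)`: a nonzero Banach space of (classes of)
random variables that is solid with a monotone norm, and such that membership and norm depend
only on the distribution. -/
structure RISpace {Ω : Type*} [MeasurableSpace Ω] (P : Measure Ω) where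
  /-- the underlying vector space of random variables modulo a.s. equality -/
  toSubmodule : Submodule ℝ (Ω →ₘ[P] ℝ)
  /-- the norm -/
  norm : toSubmodule → ℝ
  norm_add_le : ∀ X Y : toSubmodule, norm (X + Y) ≤ norm X + norm Y
  norm_smul : ∀ (c : ℝ) (X : toSubmodule), norm (c • X) = |c| * norm X
  eq_zero_of_norm_eq_zero : ∀ X : toSubmodule, norm X = 0 → X = 0
  complete : ∀ u : ℕ → toSubmodule,
    (∀ ε : ℝ, 0 < ε → ∃ N : ℕ, ∀ m n : ℕ, N ≤ m → N ≤ n → norm (u m - u n) < ε) →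
    ∃ X : toSubmodule, Filter.Tendsto (fun n => norm (u n - X)) Filter.atTop (nhds 0)
  ne_bot : toSubmodule ≠ ⊥
  solid : ∀ (X : toSubmodule) (Y : Ω →ₘ[P] ℝ),
    (∀ᵐ ω ∂P, |Y ω| ≤ |(X : Ω →ₘ[P] ℝ) ω|) →
    ∃ hY : Y ∈ toSubmodule, norm ⟨Y, hY⟩ ≤ norm X
  rearrangement : ∀ (X : toSubmodule) (Z : Ω →ₘ[P] ℝ),
    IdentDistrib Z (X : Ω →ₘ[P] ℝ) P P →
    ∃ hZ : Z ∈ toSubmodule, norm ⟨Z, hZ⟩ = norm X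

namespace RISpace

variable {Ω : Type*} [MeasurableSpace Ω] {P : Measure Ω}

/-- The type of elements of an r.i. space. -/
instance : CoeSort (RISpace P) (Type _) := ⟨fun 𝒳 => 𝒳.toSubmodule⟩

instance (𝒳 : RISpace P) : Norm 𝒳.toSubmodule := ⟨𝒳.norm⟩

/-- The two random variables have the same distribution, `X ∼ Y`. -/
def SameLaw {𝒳 : RISpace P} (X Y : 𝒳) : Prop :=
  IdentDistrib (X : Ω →ₘ[P] ℝ) (Y : Ω →ₘ[P] ℝ) P P

/-- `X` is supported in `A`: it vanishes a.s. outside `A`. -/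
def SupportedIn {𝒳 : RISpace P} (X : 𝒳) (A : Set Ω) : Prop :=
  ∀ᵐ ω ∂P, ω ∉ A → (X : Ω →ₘ[P] ℝ) ω = 0

theorem exists_restrict {𝒳 : RISpace P} (X : 𝒳) {A : Set Ω} (hA : MeasurableSet A) :
    AEEqFun.mk (A.indicator (X : Ω →ₘ[P] ℝ))
      ((X : Ω →ₘ[P] ℝ).aestronglyMeasurable.indicator hA) ∈ 𝒳.toSubmodule := by
  refine (𝒳.solid X _ ?_).1
  filter_upwards [AEEqFun.coeFn_mk (A.indicator (X : Ω →ₘ[P] ℝ))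
      ((X : Ω →ₘ[P] ℝ).aestronglyMeasurable.indicator hA)] with ω hω
  rw [hω]
  by_cases h : ω ∈ A <;> simp [h]

/-- `X 𝟏_A`, as an element of the r.i. space. -/
noncomputable def restrict {𝒳 : RISpace P} (X : 𝒳) (A : Set Ω) (hA : MeasurableSet A) : 𝒳 :=
  ⟨AEEqFun.mk (A.indicator (X : Ω →ₘ[P] ℝ))
    ((X : Ω →ₘ[P] ℝ).aestronglyMeasurable.indicator hA), exists_restrict X hA⟩

/-- The order continuous part `𝒳_a`: all `X` with `‖X 𝟏_A‖ → 0` as `P A → 0`. -/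
def orderContinuousPart (𝒳 : RISpace P) : Set 𝒳 :=
  {X | ∀ ε : ℝ, 0 < ε → ∃ δ : ℝ≥0∞, 0 < δ ∧
    ∀ (A : Set Ω) (hA : MeasurableSet A), P A < δ → ‖restrict X A hA‖ < ε}

/-- `𝒞ℒ(X)`: the convex hull of the random variables with the same distribution as `X`. -/
def CL {𝒳 : RISpace P} (X : 𝒳) : Set 𝒳 :=
  convexHull ℝ {Y : 𝒳 | SameLaw Y X}

/-- The distance `inf {‖X - Y‖ : X ∈ S, Y ∈ T}` of two (nonempty) sets. -/
noncomputable def setDist {𝒳 : RISpace P} (S T : Set 𝒳) : ℝ :=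
  sInf (Set.image2 (fun X Y : 𝒳 => ‖X - Y‖) S T)

/-- The Almost Order Continuous Equidistributional Average property. -/
def AOCEA (𝒳 : RISpace P) : Prop :=
  ∀ X : 𝒳, 0 ≤ (X : Ω →ₘ[P] ℝ) → setDist (CL X) 𝒳.orderContinuousPart = 0

end RISpace

/-! ### Intermediate values of a non-atomic measure -/

section Nonatomic

variable {Ω : Type*} [MeasurableSpace Ω] {P : Measure Ω}

/-! Since `𝒳` is not `L^∞` it contains an unbounded variable, so indicators of small sets have small
norm and bounded variables are order continuous (`RISpace.mem_orderContinuousPart_of_bounded`).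

The core is `RISpace.exists_small_average_of_dominating`. Suppose an average of copies `W i` of `|X|
𝟏_{D i}` is close to `V ∈ 𝒳_a`. For large `m`, non-atomicity gives copies `z i` of `X 𝟏_{A m}` with
`|z i| ≤ W i + 1`, vanishing off a set `S` of small measure. Hence the average of the `z i` is at
most `|∑ c i W i - V| + |V| 𝟏_S + 𝟏_S`, whose last two terms have small norm. Moving the vector `(z
i)` jointly into a prescribed set preserves the norm of the average. With `D i = Ω` this gives 1 →
4, and with `D i = A (n i)` and `V = 0` it gives 3 → 4.

For 4 → 2, take `A n = {|X| > n}`: a copy of a tail of `X` is completed to a copy of `X` by a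
bounded variable, and the average of these corrections serves as `V`. The remaining implications
specialise a set to `Ω`.

All copies come from one transfer principle, `IsNonatomic.exists_measurable_map_eq_of_label`: if
labels in `ℕ` cut `Ω` and a target law into pieces of equal masses, the law can be realised piece by
piece. -/

theorem IsNonatomic.exists_subset_measure_le_half [IsFiniteMeasure P] (hP : IsNonatomic P)
    {A : Set Ω} (hA : MeasurableSet A) (h0 : 0 < P A) :
    ∃ B ⊆ A, MeasurableSet B ∧ 0 < P B ∧ P B ≤ P A / 2 := by
  obtain ⟨B, hBA, hB, hB0, hlt⟩ := hP A hA h0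
  have hsum : P B + P (A \ B) = P A := by
    have := measure_inter_add_sdiff (μ := P) A hB
    rwa [Set.inter_eq_right.2 hBA] at this
  by_cases hc : P B ≤ P A / 2
  · exact ⟨B, hBA, hB, hB0, hc⟩
  · refine ⟨A \ B, Set.sdiff_subset, hA.diff hB, ?_, ?_⟩
    · rw [pos_iff_ne_zero]
      intro hz
      rw [hz, add_zero] at hsum
      exact hlt.ne hsum
    · push Not at hc
      by_contra hd
      push Not at hd
      have := ENNReal.add_lt_add hc hd
      rw [ENNReal.add_halves, hsum] at this
      exact this.false

theorem IsNonatomic.exists_subset_measure_lt [IsFiniteMeasure P] (hP : IsNonatomic P)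
    {A : Set Ω} (hA : MeasurableSet A) (h0 : 0 < P A) {ε : ℝ≥0∞} (hε : 0 < ε) :
    ∃ B ⊆ A, MeasurableSet B ∧ 0 < P B ∧ P B < ε := by
  have key : ∀ n : ℕ, ∃ B ⊆ A, MeasurableSet B ∧ 0 < P B ∧ P B ≤ P A * 2⁻¹ ^ n := by
    intro n
    induction n with
    | zero => exact ⟨A, subset_rfl, hA, h0, by simp⟩
    | succ n ih =>
      obtain ⟨B, hBA, hB, hB0, hle⟩ := ih
      obtain ⟨C, hCB, hC, hC0, hC'⟩ := hP.exists_subset_measure_le_half hB hB0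
      refine ⟨C, hCB.trans hBA, hC, hC0, hC'.trans ?_⟩
      rw [pow_succ, ← mul_assoc, ENNReal.div_eq_inv_mul, mul_comm]
      gcongr
  have ht : Filter.Tendsto (fun n : ℕ => P A * 2⁻¹ ^ n) Filter.atTop (nhds (P A * 0)) :=
    ENNReal.Tendsto.const_mul
      (ENNReal.tendsto_pow_atTop_nhds_zero_of_lt_one (by norm_num)) (Or.inr (measure_ne_top P A))
  rw [mul_zero] at ht
  obtain ⟨n, hn⟩ := (ht.eventually_lt_const hε).exists
  obtain ⟨B, h1, h2, h3, h4⟩ := key n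
  exact ⟨B, h1, h2, h3, h4.trans_lt hn⟩

/-- Sierpiński: a nonatomic finite measure takes all intermediate values. -/
theorem IsNonatomic.exists_subset_measure_eq [IsFiniteMeasure P] (hP : IsNonatomic P)
    {A : Set Ω} (hA : MeasurableSet A) {t : ℝ≥0∞} (ht : t ≤ P A) :
    ∃ B ⊆ A, MeasurableSet B ∧ P B = t := by
  -- Greedy exhaustion: each extension in an increasing chain comes within `2⁻¹ ^ n` of every
  -- admissible competitor. If the union fell short of `t`, a small leftover piece could be added at
  -- every stage, which forces its measure to be zero.
  let Q : Set Ω → Prop := fun C => C ⊆ A ∧ MeasurableSet C ∧ P C ≤ t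
  have htop : t ≠ ∞ := (ht.trans_lt (measure_lt_top P A)).ne
  have step : ∀ (n : ℕ) (C : Subtype Q), ∃ C' : Subtype Q, C.1 ⊆ C'.1 ∧
      ∀ D : Subtype Q, C.1 ⊆ D.1 → P D.1 ≤ P C'.1 + 2⁻¹ ^ n := by
    intro n C
    by_contra! hcon
    let F : ℝ≥0∞ := ⨆ (D : Subtype Q) (_ : C.1 ⊆ D.1), P D.1
    have hF : F ≤ t := iSup₂_le fun D _ => D.2.2.2
    have hle : ∀ D : Subtype Q, C.1 ⊆ D.1 → P D.1 + 2⁻¹ ^ n ≤ F := by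
      intro D hD
      obtain ⟨E, hE, hlt⟩ := hcon D hD
      exact hlt.le.trans (le_iSup₂_of_le E hE le_rfl)
    have h1 : F + 2⁻¹ ^ n ≤ F := by
      have : F ≤ F - 2⁻¹ ^ n := iSup₂_le fun D hD =>
        ENNReal.le_sub_of_add_le_right (by simp) (hle D hD)
      have h2 : (2⁻¹ : ℝ≥0∞) ^ n ≤ F := le_add_self.trans (hle C subset_rfl)
      calc F + 2⁻¹ ^ n ≤ F - 2⁻¹ ^ n + 2⁻¹ ^ n := by gcongr
        _ = F := tsub_add_cancel_of_le h2
    have h3 : F ≠ ∞ := (hF.trans_lt htop.lt_top).ne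
    have h4 : (2⁻¹ : ℝ≥0∞) ^ n ≠ 0 := by simp
    exact absurd h1 (ENNReal.lt_add_right h3 h4).not_ge
  choose next hsub hnext using step
  let c : ℕ → Subtype Q := fun n =>
    Nat.rec ⟨∅, Set.empty_subset _, MeasurableSet.empty, by simp⟩ (fun n C => next n C) n
  have hc : ∀ n, c (n + 1) = next n (c n) := fun n => rfl
  have hmono : Monotone fun n => (c n).1 := monotone_nat_of_le_succ fun n => by
    rw [hc]; exact hsub n (c n)
  have hCA : (⋃ n, (c n).1) ⊆ A := Set.iUnion_subset fun n => (c n).2.1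
  have hCm : MeasurableSet (⋃ n, (c n).1) := MeasurableSet.iUnion fun n => (c n).2.2.1
  have hCt : P (⋃ n, (c n).1) ≤ t := by
    rw [hmono.measure_iUnion]
    exact iSup_le fun n => (c n).2.2.2
  refine ⟨⋃ n, (c n).1, hCA, hCm, hCt.antisymm ?_⟩
  by_contra! hlt
  have hpos : 0 < P (A \ ⋃ n, (c n).1) := by
    rw [measure_sdiff hCA hCm.nullMeasurableSet (measure_ne_top _ _)]
    exact tsub_pos_of_lt (hlt.trans_le ht)
  obtain ⟨D, hDA, hD, hD0, hDlt⟩ :=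
    hP.exists_subset_measure_lt (hA.diff hCm) hpos (tsub_pos_of_lt hlt)
  have hdisj : Disjoint (⋃ n, (c n).1) D :=
    Set.disjoint_of_subset_right hDA Set.disjoint_sdiff_right
  have hU : P ((⋃ n, (c n).1) ∪ D) = P (⋃ n, (c n).1) + P D := measure_union hdisj hD
  have hQ : Q ((⋃ n, (c n).1) ∪ D) := by
    refine ⟨Set.union_subset hCA (hDA.trans Set.sdiff_subset), hCm.union hD, ?_⟩
    rw [hU]
    calc _ ≤ P (⋃ n, (c n).1) + (t - P (⋃ n, (c n).1)) := by gcongr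
      _ = t := add_tsub_cancel_of_le hCt
  have hbd : ∀ n : ℕ, P D ≤ 2⁻¹ ^ n := by
    intro n
    have h1 := hnext n (c n) ⟨_, hQ⟩
      ((Set.subset_iUnion (fun n => (c n).1) n).trans Set.subset_union_left)
    have h2 : P (next n (c n)).1 ≤ P (⋃ n, (c n).1) :=
      measure_mono (Set.subset_iUnion (fun n => (c n).1) (n + 1))
    have h3 := h1.trans (add_le_add_left h2 _)
    simp only [hU] at h3
    exact (ENNReal.add_le_add_iff_left (measure_ne_top _ _)).1 h3
  have hz : P D ≤ 0 := ge_of_tendsto'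
    (ENNReal.tendsto_pow_atTop_nhds_zero_of_lt_one (r := 2⁻¹) (by norm_num)) hbd
  exact hD0.not_ge hz

end Nonatomic

/-! ### Realising prescribed laws on a non-atomic space -/

section Transfer

variable {Ω : Type*} [MeasurableSpace Ω] {P : Measure Ω}

/-- Two cylinders that meet are nested, so the longer word describes the intersection. `PiNat.res`
lists the newest coordinate first. -/
theorem isPiSystem_setOf_res_eq :
    IsPiSystem {C : Set (ℕ → Bool) | ∃ s : List Bool, C = {y | PiNat.res y s.length = s}} := by
  rintro _ ⟨s, rfl⟩ _ ⟨t, rfl⟩ ⟨z, hzs, hzt⟩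
  simp only [Set.mem_ofPred_eq] at hzs hzt
  wlog hst : s.length ≤ t.length generalizing s t
  · rw [Set.inter_comm]
    exact this t s hzt hzs (le_of_not_ge hst)
  refine ⟨t, ?_⟩
  rw [Set.inter_eq_right]
  intro y hy
  simp only [Set.mem_ofPred_eq] at hy ⊢
  have h1 : ∀ ⦃i⦄, i < t.length → y i = z i := PiNat.res_eq_res.1 (hy.trans hzt.symm)
  exact (PiNat.res_eq_res.2 fun i hi => h1 (hi.trans_le hst)).trans hzs

theorem measurableSet_setOf_res_eq (s : List Bool) :
    MeasurableSet {y : ℕ → Bool | PiNat.res y s.length = s} := by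
  induction s with
  | nil => simp
  | cons b s ih =>
    have : {y : ℕ → Bool | PiNat.res y (b :: s).length = b :: s} =
        {y | y s.length = b} ∩ {y | PiNat.res y s.length = s} := by
      ext y; simp
    rw [this]
    exact (measurable_pi_apply s.length (measurableSet_singleton b)).inter ih

theorem generateFrom_setOf_res_eq :
    (inferInstance : MeasurableSpace (ℕ → Bool)) = MeasurableSpace.generateFrom
      {C : Set (ℕ → Bool) | ∃ s : List Bool, C = {y | PiNat.res y s.length = s}} := by
  apply le_antisymm
  · refine iSup_le fun n => ?_
    rw [← measurable_iff_comap_le]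
    refine @measurable_to_bool _ (_) _ ?_
    have : (fun y : ℕ → Bool => y n) ⁻¹' {true} =
        ⋃ s : {s : List Bool // s.length = n},
          {y | PiNat.res y (true :: s.1).length = true :: s.1} := by
      ext y
      simp only [Set.mem_preimage, Set.mem_singleton_iff, Set.mem_iUnion, Set.mem_ofPred_eq]
      constructor
      · intro h
        exact ⟨⟨PiNat.res y n, PiNat.res_length y n⟩, by simp [h]⟩
      · rintro ⟨⟨s, rfl⟩, h⟩
        simp only [List.length_cons, PiNat.res_succ, List.cons.injEq] at h
        exact h.1
    rw [this]
    exact MeasurableSet.iUnion fun s => MeasurableSpace.measurableSet_generateFrom ⟨_, rfl⟩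
  · rw [MeasurableSpace.generateFrom_le_iff]
    rintro _ ⟨s, rfl⟩
    exact measurableSet_setOf_res_eq s

/-- Intermediate values allow `B` to be split along a binary tree whose node `s` has the mass that
`ν` gives to the cylinder of `s`. Sending a point to its branch matches the masses of all cylinders,
hence the measures. -/
theorem IsNonatomic.exists_measurable_map_restrict_eq_cantor [IsFiniteMeasure P]
    (hP : IsNonatomic P) {B : Set Ω} (hB : MeasurableSet B) (ν : Measure (ℕ → Bool))
    (hν : ν Set.univ = P B) :
    ∃ f : Ω → ℕ → Bool, Measurable f ∧ (P.restrict B).map f = ν := by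
  classical
  let cyl : List Bool → Set (ℕ → Bool) := fun s => {y | PiNat.res y s.length = s}
  have hcyl : ∀ s, MeasurableSet (cyl s) := measurableSet_setOf_res_eq
  -- The splitting is made total, so that the tree can be defined by recursion before its masses are
  -- known.
  have hex : ∀ (A : Set Ω) (t : ℝ≥0∞), ∃ C : Set Ω, MeasurableSet A → t ≤ P A →
      C ⊆ A ∧ MeasurableSet C ∧ P C = t := by
    intro A t
    by_cases h : MeasurableSet A ∧ t ≤ P A
    · obtain ⟨C, hC⟩ := hP.exists_subset_measure_eq h.1 h.2
      exact ⟨C, fun _ _ => hC⟩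
    · exact ⟨∅, fun h1 h2 => absurd ⟨h1, h2⟩ h⟩
  choose sp hsp using hex
  let D : List Bool → Set Ω := fun s => List.rec B
    (fun b s A => if b then sp A (ν (cyl (true :: s))) else A \ sp A (ν (cyl (true :: s)))) s
  have hD0 : D [] = B := rfl
  have hDt : ∀ s, D (true :: s) = sp (D s) (ν (cyl (true :: s))) := fun s => rfl
  have hDf : ∀ s, D (false :: s) = D s \ D (true :: s) := fun s => rfl
  have hsplit : ∀ s, ν (cyl (true :: s)) + ν (cyl (false :: s)) = ν (cyl s) := by
    intro s
    have h1 : cyl (true :: s) = cyl s ∩ cyl (true :: s) := by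
      ext y; simp +contextual [cyl]
    have h2 : cyl (false :: s) = cyl s \ cyl (true :: s) := by
      ext y
      simp only [cyl, List.length_cons, PiNat.res_succ, List.cons.injEq, Set.mem_sdiff,
        Set.mem_ofPred_eq]
      cases y s.length <;> simp
    conv_lhs => rw [h1, h2]
    exact measure_inter_add_sdiff _ (hcyl _)
  have hD : ∀ s, MeasurableSet (D s) ∧ P (D s) = ν (cyl s) := by
    intro s
    induction s with
    | nil => exact ⟨hB, by simp [hD0, cyl, hν]⟩
    | cons b s ih =>
      have hle : ν (cyl (true :: s)) ≤ P (D s) := by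
        rw [ih.2, ← hsplit s]; exact le_self_add
      obtain ⟨h1, h2, h3⟩ := hsp (D s) _ ih.1 hle
      rw [← hDt] at h1 h2 h3
      cases b with
      | true => exact ⟨h2, h3⟩
      | false =>
        refine ⟨ih.1.diff h2, ?_⟩
        rw [hDf, measure_sdiff h1 h2.nullMeasurableSet (measure_ne_top _ _), h3, ih.2, ← hsplit s]
        refine ENNReal.add_sub_cancel_left ?_
        rw [← h3]; exact measure_ne_top _ _
  have hDsub : ∀ b s, D (b :: s) ⊆ D s := by
    intro b s
    cases b with
    | false => exact Set.sdiff_subset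
    | true =>
      have hle : ν (cyl (true :: s)) ≤ P (D s) := by
        rw [(hD s).2, ← hsplit s]; exact le_self_add
      exact (hsp (D s) _ (hD s).1 hle).1
  -- The branch of `ω`. Outside `B` it is constantly `false`, so membership in `B` must be assumed
  -- to read off `D s` from it.
  let R : Ω → ℕ → List Bool := fun ω n =>
    Nat.rec [] (fun _ s => decide (ω ∈ D (true :: s)) :: s) n
  have hR0 : ∀ ω, R ω 0 = [] := fun ω => rfl
  have hRs : ∀ ω n, R ω (n + 1) = decide (ω ∈ D (true :: R ω n)) :: R ω n := fun ω n => rfl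
  let f : Ω → ℕ → Bool := fun ω n => decide (ω ∈ D (true :: R ω n))
  have hres : ∀ ω n, PiNat.res (f ω) n = R ω n := by
    intro ω n
    induction n with
    | zero => rfl
    | succ n ih => rw [PiNat.res_succ, ih, hRs]
  have hRD : ∀ ω ∈ B, ∀ s : List Bool, R ω s.length = s ↔ ω ∈ D s := by
    intro ω hω s
    induction s with
    | nil => simp [hR0, hD0, hω]
    | cons b s ih =>
      rw [List.length_cons, hRs, List.cons.injEq, ih]
      constructor
      · rintro ⟨h1, h2⟩
        rw [ih.2 h2] at h1
        cases b with
        | true => simpa using h1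
        | false => exact ⟨h2, of_decide_eq_false h1⟩
      · intro h
        have h2 := hDsub b s h
        refine ⟨?_, h2⟩
        rw [ih.2 h2]
        cases b with
        | true => simpa using h
        | false => exact decide_eq_false h.2
  have hRm : ∀ n s, MeasurableSet {ω | R ω n = s} := by
    intro n
    induction n with
    | zero => intro s; simp [hR0]
    | succ n ih =>
      intro s
      cases s with
      | nil => simp [hRs]
      | cons b s =>
        have : {ω | R ω (n + 1) = b :: s} =
            {ω | R ω n = s} ∩ {ω | decide (ω ∈ D (true :: s)) = b} := by
          ext ω
          simp only [hRs, List.cons.injEq, Set.mem_ofPred_eq, Set.mem_inter_iff]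
          constructor
          · rintro ⟨h1, h2⟩; rw [h2] at h1; exact ⟨h2, h1⟩
          · rintro ⟨h1, h2⟩; rw [h1]; exact ⟨h2, rfl⟩
        rw [this]
        refine (ih s).inter ?_
        cases b with
        | true => simpa using (hD (true :: s)).1
        | false =>
          simp only [decide_eq_false_iff_not]
          exact (hD (true :: s)).1.compl
  have hf : Measurable f := by
    rw [measurable_pi_iff]
    intro n
    refine measurable_to_bool ?_
    have : (fun ω => f ω n) ⁻¹' {true} = ⋃ s, {ω | R ω n = s} ∩ D (true :: s) := by
      ext ω; simp [f]
    rw [this]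
    exact MeasurableSet.iUnion fun s => (hRm n s).inter (hD (true :: s)).1
  refine ⟨f, hf, ?_⟩
  refine ext_of_generate_finite _ generateFrom_setOf_res_eq isPiSystem_setOf_res_eq ?_ ?_
  · rintro _ ⟨s, rfl⟩
    rw [Measure.map_apply hf (hcyl s), Measure.restrict_apply (hf (hcyl s)), ← (hD s).2]
    congr 1
    ext ω
    have hmem : ω ∈ f ⁻¹' cyl s ↔ R ω s.length = s := by
      rw [← hres]; rfl
    rw [Set.mem_inter_iff, hmem]
    constructor
    · rintro ⟨h1, h2⟩; exact (hRD ω h2 s).1 h1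
    · intro h
      have hωB : ω ∈ B := by
        clear * - h hDsub hD0
        induction s with
        | nil => exact h
        | cons b s ih => exact ih (hDsub b s h)
      exact ⟨(hRD ω hωB s).2 h, hωB⟩
  · rw [Measure.map_apply hf MeasurableSet.univ]
    simp [hν]

/-- A measurable set of a nonatomic space carries a random element with any prescribed law of
the right mass. -/
theorem IsNonatomic.exists_measurable_map_restrict_eq [IsFiniteMeasure P] (hP : IsNonatomic P)
    {S : Type*} [MeasurableSpace S] [StandardBorelSpace S] [Nonempty S]
    {B : Set Ω} (hB : MeasurableSet B) (ν : Measure S) (hν : ν Set.univ = P B) :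
    ∃ f : Ω → S, Measurable f ∧ (P.restrict B).map f = ν := by
  obtain ⟨e, he, hinj⟩ := MeasurableSpace.measurable_injection_nat_bool_of_countablySeparated S
  have hemb : MeasurableEmbedding e := he.measurableEmbedding hinj
  obtain ⟨f, hf, hmap⟩ := hP.exists_measurable_map_restrict_eq_cantor hB (ν.map e)
    (by rw [Measure.map_apply he MeasurableSet.univ]; simpa using hν)
  refine ⟨hemb.invFun ∘ f, hemb.measurable_invFun.comp hf, ?_⟩
  rw [← Measure.map_map hemb.measurable_invFun hf, hmap,
    Measure.map_map hemb.measurable_invFun he, hemb.leftInverse_invFun.id, Measure.map_id]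

theorem measure_eq_tsum_inter_preimage_singleton {T : Type*} [MeasurableSpace T] {μ : Measure T}
    {J : T → ℕ} (hJ : Measurable J) {E : Set T} (hE : MeasurableSet E) :
    μ E = ∑' j, μ (E ∩ J ⁻¹' {j}) := by
  have hu : (⋃ j, E ∩ J ⁻¹' {j}) = E := by ext; simp
  rw [← measure_iUnion, hu]
  · exact fun i j hij => (Disjoint.preimage J (Set.disjoint_singleton.2 hij)).mono
      Set.inter_subset_right Set.inter_subset_right
  · exact fun j => hE.inter (hJ (measurableSet_singleton j))

theorem measure_compl_preimage_zero_eq_tsum {T : Type*} [MeasurableSpace T] {μ : Measure T}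
    {g : T → ℕ} (hg : Measurable g) :
    μ (g ⁻¹' {0})ᶜ = ∑' j, if j = 0 then 0 else μ (g ⁻¹' {j}) := by
  rw [measure_eq_tsum_inter_preimage_singleton hg (hg (measurableSet_singleton 0)).compl]
  refine tsum_congr fun j => ?_
  split_ifs with hj
  · simp [hj]
  · congr 1
    ext x
    simp +contextual [hj]

/-- If the label `h` under the law `ν` is distributed like the label `J` on `Ω`, then there is a
random element of law `ν` whose label is `J`. -/
theorem IsNonatomic.exists_measurable_map_eq_of_label [IsFiniteMeasure P] (hP : IsNonatomic P)
    {S : Type*} [MeasurableSpace S] [StandardBorelSpace S] [Nonempty S] (ν : Measure S)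
    {J : Ω → ℕ} (hJ : Measurable J) {h : S → ℕ} (hh : Measurable h)
    (huniv : P Set.univ = ν Set.univ) (hlab : ∀ j ≠ 0, P (J ⁻¹' {j}) = ν (h ⁻¹' {j})) :
    ∃ Z : Ω → S, Measurable Z ∧ P.map Z = ν ∧ ∀ᵐ ω ∂P, h (Z ω) = J ω := by
  have hJh : ∀ j, P (J ⁻¹' {j}) = ν (h ⁻¹' {j}) := by
    intro j
    rcases eq_or_ne j 0 with rfl | hj
    -- Label `0` is whatever the other labels leave of the common finite total mass.
    · have h1 : P (J ⁻¹' {0})ᶜ = ν (h ⁻¹' {0})ᶜ := by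
        rw [measure_compl_preimage_zero_eq_tsum hJ, measure_compl_preimage_zero_eq_tsum hh]
        refine tsum_congr fun j => ?_
        split_ifs with hj
        · rfl
        · exact hlab j hj
      have h2 := measure_add_measure_compl (μ := P) (hJ (measurableSet_singleton 0))
      rw [huniv, ← measure_add_measure_compl (μ := ν) (hh (measurableSet_singleton 0)), h1] at h2
      exact (ENNReal.add_left_inj (by rw [← h1]; exact measure_ne_top _ _)).1 h2
    · exact hlab j hj
  -- On each piece of `Ω` the matching piece of `ν` is realised; gluing along `J` gives `Z`.
  have hex : ∀ j, ∃ f : Ω → S, Measurable f ∧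
      (P.restrict (J ⁻¹' {j})).map f = ν.restrict (h ⁻¹' {j}) := fun j =>
    hP.exists_measurable_map_restrict_eq (hJ (measurableSet_singleton j)) _ (by simp [hJh])
  choose f hf hmap using hex
  have hJs : ∀ j, MeasurableSet (J ⁻¹' {j}) := fun j => hJ (measurableSet_singleton j)
  have hhs : ∀ j, MeasurableSet (h ⁻¹' {j}) := fun j => hh (measurableSet_singleton j)
  let Z : Ω → S := fun ω => f (J ω) ω
  have hZ : Measurable Z := by
    have h1 : Measurable fun p : Ω × ℕ => f p.2 p.1 := measurable_from_prod_countable_left hf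
    exact h1.comp (measurable_id.prodMk hJ)
  have hfib : ∀ (E : Set S), MeasurableSet E → ∀ j,
      P (Z ⁻¹' E ∩ J ⁻¹' {j}) = ν (E ∩ h ⁻¹' {j}) := by
    intro E hE j
    rw [← Measure.restrict_apply hE, ← hmap, Measure.map_apply (hf j) hE,
      Measure.restrict_apply (hf j hE)]
    congr 1
    ext ω
    simp only [Set.mem_inter_iff, Set.mem_preimage, Set.mem_singleton_iff, Z]
    constructor
    · rintro ⟨h1, h2⟩; rw [h2] at h1; exact ⟨h1, h2⟩
    · rintro ⟨h1, h2⟩; rw [h2]; exact ⟨h1, rfl⟩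
  refine ⟨Z, hZ, ?_, ?_⟩
  · ext E hE
    rw [Measure.map_apply hZ hE]
    rw [measure_eq_tsum_inter_preimage_singleton hJ (hZ hE),
      measure_eq_tsum_inter_preimage_singleton hh hE]
    exact tsum_congr (hfib E hE)
  · have : ∀ j, ∀ᵐ ω ∂P, J ω = j → h (Z ω) = j := by
      intro j
      have h1 := hfib (h ⁻¹' {j})ᶜ (hhs j).compl j
      rw [Set.compl_inter_self, measure_empty] at h1
      rw [ae_iff]
      convert h1 using 2
      ext ω
      simp [and_comm]
    filter_upwards [ae_all_iff.2 this] with ω hω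
    exact hω _ rfl

end Transfer

/-! ### Couplings with bounds or prescribed supports -/

section Couplings

variable {Ω : Type*} [MeasurableSpace Ω] {P : Measure Ω}

theorem map_univ_of_measurable {S : Type*} [MeasurableSpace S] {Y : Ω → S} (hY : Measurable Y) :
    P Set.univ = P.map Y Set.univ := by
  rw [Measure.map_apply hY MeasurableSet.univ, Set.preimage_univ]

theorem measurable_natFloor_abs : Measurable fun x : ℝ => ⌊|x|⌋₊ :=
  Nat.measurable_floor.comp measurable_id.abs

/-- If `|Y|` is less spread than `|W|` over the integer levels, then some copy of `Y` is bounded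
by `|W| + 1`. -/
theorem IsNonatomic.exists_map_eq_abs_le_add_one [IsFiniteMeasure P] (hP : IsNonatomic P)
    {Y W : Ω → ℝ} (hY : Measurable Y) (hW : Measurable W)
    (hle : ∀ j : ℕ, j ≠ 0 → P {ω | ⌊|Y ω|⌋₊ = j} ≤ P {ω | ⌊|W ω|⌋₊ = j}) :
    ∃ Z : Ω → ℝ, Measurable Z ∧ P.map Z = P.map Y ∧ ∀ᵐ ω ∂P, |Z ω| ≤ |W ω| + 1 := by
  classical
  have hWm : Measurable fun ω => ⌊|W ω|⌋₊ := measurable_natFloor_abs.comp hW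
  -- Inside each nonzero level of `|W|` a part with the mass of the same level of `|Y|` is labelled
  -- `j`; all else is labelled `0`. Then `⌊|Z|⌋₊ ≤ ⌊|W|⌋₊` almost surely, and the `+ 1` absorbs
  -- fractional parts.
  have hex : ∀ j : ℕ, ∃ D ⊆ {ω | ⌊|W ω|⌋₊ = j}, MeasurableSet D ∧
      (j ≠ 0 → P D = P {ω | ⌊|Y ω|⌋₊ = j}) := by
    intro j
    by_cases hj : j = 0
    · exact ⟨∅, Set.empty_subset _, MeasurableSet.empty, fun h => absurd hj h⟩
    · obtain ⟨D, h1, h2, h3⟩ := hP.exists_subset_measure_eq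
        (hWm (measurableSet_singleton j)) (hle j hj)
      exact ⟨D, h1, h2, fun _ => h3⟩
  choose D hDsub hD hPD using hex
  let J : Ω → ℕ := fun ω => if ω ∈ D ⌊|W ω|⌋₊ then ⌊|W ω|⌋₊ else 0
  have hJm : Measurable J := by
    have h1 : Measurable fun p : Ω × ℕ => if p.1 ∈ D p.2 then p.2 else 0 :=
      measurable_from_prod_countable_left fun j =>
        Measurable.ite (hD j) measurable_const measurable_const
    exact h1.comp (measurable_id.prodMk hWm)
  have hJD : ∀ j, j ≠ 0 → J ⁻¹' {j} = D j := by
    intro j hj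
    ext ω
    simp only [Set.mem_preimage, Set.mem_singleton_iff, J]
    constructor
    · intro h
      split_ifs at h with hω
      · rwa [h] at hω
      · exact absurd h.symm hj
    · intro h
      have hW' : ⌊|W ω|⌋₊ = j := hDsub j h
      rw [hW', if_pos h]
  obtain ⟨Z, hZ, hmap, hlab⟩ := hP.exists_measurable_map_eq_of_label (P.map Y) hJm
    measurable_natFloor_abs (map_univ_of_measurable hY) (fun j hj => by
      rw [hJD j hj, hPD j hj,
        Measure.map_apply hY (measurable_natFloor_abs (measurableSet_singleton j))]
      rfl)
  refine ⟨Z, hZ, hmap, ?_⟩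
  filter_upwards [hlab] with ω hω
  have h1 : |Z ω| < ⌊|Z ω|⌋₊ + 1 := Nat.lt_floor_add_one _
  have h2 : ((⌊|W ω|⌋₊ : ℕ) : ℝ) ≤ |W ω| := Nat.floor_le (abs_nonneg _)
  have h3 : J ω ≤ ⌊|W ω|⌋₊ := by
    simp only [J]
    split_ifs <;> simp
  rw [hω] at h1
  have h4 : (J ω : ℝ) ≤ (⌊|W ω|⌋₊ : ℕ) := by exact_mod_cast h3
  linarith

/-- A random element can be moved, with its law, into any set that is at least as large as its
support. -/
theorem IsNonatomic.exists_map_eq_supported [IsFiniteMeasure P] (hP : IsNonatomic P)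
    {S : Type*} [MeasurableSpace S] [StandardBorelSpace S] [Zero S]
    {Z : Ω → S} (hZ : Measurable Z) {B : Set Ω} (hB : MeasurableSet B)
    (hle : P {ω | Z ω ≠ 0} ≤ P B) :
    ∃ Z' : Ω → S, Measurable Z' ∧ P.map Z' = P.map Z ∧ ∀ᵐ ω ∂P, ω ∉ B → Z' ω = 0 := by
  classical
  obtain ⟨C, hCB, hC, hPC⟩ := hP.exists_subset_measure_eq hB hle
  let J : Ω → ℕ := fun ω => if ω ∈ C then 1 else 0
  have hJ : Measurable J := Measurable.ite hC measurable_const measurable_const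
  let h : S → ℕ := fun x => if x = 0 then 0 else 1
  have hh : Measurable h :=
    Measurable.ite (measurableSet_singleton 0) measurable_const measurable_const
  obtain ⟨Z', hZ', hmap, hlab⟩ := hP.exists_measurable_map_eq_of_label (P.map Z) hJ hh
    (map_univ_of_measurable hZ) (fun j hj => by
      rw [Measure.map_apply hZ (hh (measurableSet_singleton j))]
      rcases eq_or_ne j 1 with rfl | h1
      · convert hPC using 2
        · ext ω; simp [J]
        · ext ω; simp [h]
      · have e1 : J ⁻¹' {j} = ∅ := by
          ext ω
          simp only [J, Set.mem_preimage, Set.mem_singleton_iff, Set.mem_empty_iff_false]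
          split_ifs <;> simp [hj.symm, h1.symm]
        have e2 : h ⁻¹' {j} = ∅ := by
          ext ω
          simp only [h, Set.mem_preimage, Set.mem_singleton_iff, Set.mem_empty_iff_false]
          split_ifs <;> simp [hj.symm, h1.symm]
        simp [e1, e2])
  refine ⟨Z', hZ', hmap, ?_⟩
  filter_upwards [hlab] with ω hω hωB
  have hωC : ω ∉ C := fun hc => hωB (hCB hc)
  by_contra hne
  simp [h, J, hne, hωC] at hω

/-- A copy of the tail `X 𝟏_{|X| > r}` inside `A` extends, by a random variable bounded by `r`,
to a copy of `X` inside `A`. -/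
theorem IsNonatomic.exists_bounded_extension [IsFiniteMeasure P] (hP : IsNonatomic P)
    {X Z : Ω → ℝ} (hX : Measurable X) (hZ : Measurable Z) {A : Set Ω} (hA : MeasurableSet A)
    (hXA : ∀ᵐ ω ∂P, ω ∉ A → X ω = 0) {r : ℝ} (hr : 0 ≤ r)
    (hlaw : P.map Z = P.map ({ω | r < |X ω|}.indicator X)) :
    ∃ U : Ω → ℝ, Measurable U ∧ (∀ᵐ ω ∂P, |U ω| ≤ r) ∧ (∀ᵐ ω ∂P, ω ∉ A → U ω = 0) ∧
      P.map (fun ω => Z ω + U ω) = P.map X := by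
  classical
  let T : Set ℝ := {x | r < |x|}
  have hT : MeasurableSet T := measurableSet_lt measurable_const measurable_id.abs
  have hT0 : ∀ x ∈ T, x ≠ 0 := by
    rintro x hx rfl
    simp only [T, Set.mem_ofPred_eq, abs_zero] at hx
    exact hx.not_ge hr
  have hXT : MeasurableSet (X ⁻¹' T) := hX hT
  have hZ0 : MeasurableSet {ω | Z ω ≠ 0} := (hZ (measurableSet_singleton 0)).compl
  have htail : ∀ E : Set ℝ, MeasurableSet E →
      P (Z ⁻¹' E ∩ {ω | Z ω ≠ 0}) = P (X ⁻¹' (E ∩ T)) := by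
    intro E hE
    have h1 := congrArg (fun μ : Measure ℝ => μ (E \ {0})) hlaw
    have hE0 : MeasurableSet (E \ {0}) := hE.diff (measurableSet_singleton 0)
    have hXi : Measurable ({ω | r < |X ω|}.indicator X) := hX.indicator hXT
    simp only [Measure.map_apply hZ hE0, Measure.map_apply hXi hE0] at h1
    have e1 : Z ⁻¹' E ∩ {ω | Z ω ≠ 0} = Z ⁻¹' (E \ {0}) := by
      ext ω; simp
    have e2 : {ω | r < |X ω|}.indicator X ⁻¹' (E \ {0}) = X ⁻¹' (E ∩ T) := by
      ext ω
      by_cases hω : r < |X ω|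
      · have := hT0 (X ω) hω
        simp [T, hω, this]
      · simp [T, hω]
    rw [e1, h1, e2]
  have hZT : P {ω | Z ω ≠ 0} = P (X ⁻¹' T) := by simpa using htail Set.univ MeasurableSet.univ
  -- There is room in `A`, off the support of `Z`, for the nonzero values of `X` of size at most
  -- `r`.
  have hG : P ({ω | X ω ≠ 0} \ X ⁻¹' T) ≤ P (A \ {ω | Z ω ≠ 0}) := by
    have h1 : P {ω | X ω ≠ 0} ≤ P A := measure_mono_ae (by
      filter_upwards [hXA] with ω hω hne
      by_contra hωA
      exact hne (hω hωA))
    have hsub : X ⁻¹' T ⊆ {ω | X ω ≠ 0} := fun ω hω => hT0 _ hω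
    rw [measure_sdiff hsub hXT.nullMeasurableSet (measure_ne_top _ _), ← hZT]
    exact (tsub_le_tsub_right h1 _).trans le_measure_sdiff
  obtain ⟨G, hGA, hGm, hPG⟩ := hP.exists_subset_measure_eq (hA.diff hZ0) hG
  -- Label `2` stands for the tail values, `1` for the nonzero values of size at most `r`, `0` for
  -- zero.
  let J : Ω → ℕ := fun ω => if Z ω ≠ 0 then 2 else if ω ∈ G then 1 else 0
  have hJ : Measurable J := Measurable.ite hZ0 measurable_const
    (Measurable.ite hGm measurable_const measurable_const)
  let h : ℝ → ℕ := fun x => if x ∈ T then 2 else if x ≠ 0 then 1 else 0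
  have hh : Measurable h := Measurable.ite hT measurable_const
    (Measurable.ite (measurableSet_singleton 0).compl measurable_const measurable_const)
  have hJ2 : J ⁻¹' {2} = {ω | Z ω ≠ 0} := by
    ext ω
    simp only [J, Set.mem_preimage, Set.mem_singleton_iff, Set.mem_ofPred_eq]
    split_ifs <;> simp_all
  have hJ1 : J ⁻¹' {1} = G := by
    ext ω
    simp only [J, Set.mem_preimage, Set.mem_singleton_iff]
    split_ifs with h1 h2
    · simp only [OfNat.ofNat_ne_one, false_iff]
      exact fun hg => (hGA hg).2 h1
    · simp [h2]
    · simp [h2]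
  have hh2 : h ⁻¹' {2} = T := by
    ext x
    simp only [h, Set.mem_preimage, Set.mem_singleton_iff]
    split_ifs <;> simp_all
  have hh1 : X ⁻¹' (h ⁻¹' {1}) = {ω | X ω ≠ 0} \ X ⁻¹' T := by
    ext ω
    simp only [h, Set.mem_preimage, Set.mem_singleton_iff, Set.mem_sdiff, Set.mem_ofPred_eq]
    split_ifs <;> simp_all
  obtain ⟨Y, hY, hmap, hlab⟩ := hP.exists_measurable_map_eq_of_label (P.map X) hJ hh
    (map_univ_of_measurable hX) (fun j hj => by
      rw [Measure.map_apply hX (hh (measurableSet_singleton j))]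
      rcases eq_or_ne j 1 with rfl | h1
      · rw [hJ1, hh1, hPG]
      rcases eq_or_ne j 2 with rfl | h2
      · rw [hJ2, hh2, hZT]
      have e1 : J ⁻¹' {j} = ∅ := by
        ext ω
        simp only [J, Set.mem_preimage, Set.mem_singleton_iff, Set.mem_empty_iff_false]
        split_ifs <;> simp [hj.symm, h1.symm, h2.symm]
      have e2 : h ⁻¹' {j} = ∅ := by
        ext ω
        simp only [h, Set.mem_preimage, Set.mem_singleton_iff, Set.mem_empty_iff_false]
        split_ifs <;> simp [hj.symm, h1.symm, h2.symm]
      simp [e1, e2])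
  have hsum : Measurable fun ω => Z ω + G.indicator Y ω := hZ.add (hY.indicator hGm)
  refine ⟨G.indicator Y, hY.indicator hGm, ?_, ?_, ?_⟩
  · filter_upwards [hlab] with ω hω
    by_cases hg : ω ∈ G
    · have hJω : J ω = 1 := by
        have : ω ∈ J ⁻¹' {1} := by rw [hJ1]; exact hg
        exact this
      rw [hJω] at hω
      rw [Set.indicator_of_mem hg]
      by_contra! hc
      have hYT : Y ω ∈ T := hc
      simp [h, hYT] at hω
    · simpa [hg] using hr
  · refine Filter.Eventually.of_forall fun ω hω => Set.indicator_of_notMem ?_ _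
    exact fun hg => hω (hGA hg).1
  -- Off the support of `Z`, the sum is almost surely `Y`. On it the sum is `Z`, which need not
  -- equal `Y` but has the same tail law there.
  · rw [← hmap]
    ext E hE
    rw [Measure.map_apply hsum hE, Measure.map_apply hY hE,
      ← measure_inter_add_sdiff _ hZ0, ← measure_inter_add_sdiff (Y ⁻¹' E) hZ0]
    congr 1
    · have h1 : (fun ω => Z ω + G.indicator Y ω) ⁻¹' E ∩ {ω | Z ω ≠ 0} =
          Z ⁻¹' E ∩ {ω | Z ω ≠ 0} := by
        ext ω
        by_cases hz : Z ω = 0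
        · simp [hz]
        · have : ω ∉ G := fun hg => (hGA hg).2 hz
          simp [this]
      have h2 : P (Y ⁻¹' E ∩ {ω | Z ω ≠ 0}) = P (Y ⁻¹' (E ∩ T)) := by
        refine measure_congr ?_
        filter_upwards [hlab] with ω hω
        have h3 : Z ω ≠ 0 ↔ Y ω ∈ T := by
          rw [← hh2, Set.mem_preimage, hω]
          change ω ∈ {ω | Z ω ≠ 0} ↔ ω ∈ J ⁻¹' {2}
          rw [hJ2]
        apply propext
        change (Y ω ∈ E ∧ Z ω ≠ 0) ↔ (Y ω ∈ E ∧ Y ω ∈ T)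
        rw [h3]
      rw [h1, h2, htail E hE, ← Measure.map_apply hX (hE.inter hT), ← hmap,
        Measure.map_apply hY (hE.inter hT)]
    · refine measure_congr ?_
      filter_upwards [hlab] with ω hω
      apply propext
      change (Z ω + G.indicator Y ω ∈ E ∧ ¬ Z ω ≠ 0) ↔ (Y ω ∈ E ∧ ¬ Z ω ≠ 0)
      by_cases hz : Z ω = 0
      · by_cases hg : ω ∈ G
        · simp [hz, hg]
        · have hY0 : Y ω = 0 := by
            by_contra hne
            simp only [h, J, hz, hg] at hω
            split_ifs at hω <;> simp_all
          simp [hz, hg, hY0]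
      · simp [hz]

end Couplings

/-! ### Norm and pointwise calculus in an r.i. space -/

namespace RISpace

section Basic

variable {Ω : Type*} [MeasurableSpace Ω] {P : Measure Ω} {𝒳 : RISpace P}

theorem norm_add_le' (X Y : 𝒳) : ‖X + Y‖ ≤ ‖X‖ + ‖Y‖ := 𝒳.norm_add_le X Y

theorem norm_smul' (c : ℝ) (X : 𝒳) : ‖c • X‖ = |c| * ‖X‖ := 𝒳.norm_smul c X

theorem norm_zero' : ‖(0 : 𝒳)‖ = 0 := by
  have := norm_smul' (0 : ℝ) (0 : 𝒳)
  simpa using this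

theorem norm_neg' (X : 𝒳) : ‖-X‖ = ‖X‖ := by
  rw [← neg_one_smul ℝ X, norm_smul', abs_neg, abs_one, one_mul]

theorem norm_nonneg' (X : 𝒳) : 0 ≤ ‖X‖ := by
  have := norm_add_le' X (-X)
  rw [add_neg_cancel, norm_zero', norm_neg'] at this
  linarith

theorem exists_of_abs_le (X : 𝒳) {Y : Ω → ℝ} (hY : AEStronglyMeasurable Y P)
    (h : ∀ᵐ ω ∂P, |Y ω| ≤ |(X : Ω →ₘ[P] ℝ) ω|) :
    ∃ Y' : 𝒳, (Y' : Ω →ₘ[P] ℝ) =ᵐ[P] Y := by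
  obtain ⟨hm, -⟩ := 𝒳.solid X (AEEqFun.mk Y hY) (by
    filter_upwards [h, AEEqFun.coeFn_mk Y hY] with ω h1 h2
    rwa [h2])
  exact ⟨⟨_, hm⟩, AEEqFun.coeFn_mk Y hY⟩

theorem norm_le_of_abs_le {X Y : 𝒳}
    (h : ∀ᵐ ω ∂P, |(Y : Ω →ₘ[P] ℝ) ω| ≤ |(X : Ω →ₘ[P] ℝ) ω|) : ‖Y‖ ≤ ‖X‖ :=
  (𝒳.solid X Y h).2

theorem norm_eq_of_sameLaw {X Y : 𝒳} (h : SameLaw Y X) : ‖Y‖ = ‖X‖ :=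
  (𝒳.rearrangement X Y h).2

theorem exists_sameLaw (X : 𝒳) {Z : Ω → ℝ} (h : IdentDistrib Z (X : Ω →ₘ[P] ℝ) P P) :
    ∃ Z' : 𝒳, (Z' : Ω →ₘ[P] ℝ) =ᵐ[P] Z ∧ SameLaw Z' X := by
  have hZ := h.aemeasurable_fst.aestronglyMeasurable
  have h1 := AEEqFun.coeFn_mk Z hZ
  have h2 : IdentDistrib (AEEqFun.mk Z hZ) (X : Ω →ₘ[P] ℝ) P P :=
    (IdentDistrib.of_ae_eq h.aemeasurable_fst h1.symm).symm.trans h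
  obtain ⟨hm, -⟩ := 𝒳.rearrangement X _ h2
  exact ⟨⟨_, hm⟩, h1, h2⟩

theorem coe_add (X Y : 𝒳) : ((X + Y : 𝒳) : Ω →ₘ[P] ℝ) =ᵐ[P] fun ω =>
    (X : Ω →ₘ[P] ℝ) ω + (Y : Ω →ₘ[P] ℝ) ω := by
  exact AEEqFun.coeFn_add (X : Ω →ₘ[P] ℝ) (Y : Ω →ₘ[P] ℝ)

theorem coe_sub (X Y : 𝒳) : ((X - Y : 𝒳) : Ω →ₘ[P] ℝ) =ᵐ[P] fun ω =>
    (X : Ω →ₘ[P] ℝ) ω - (Y : Ω →ₘ[P] ℝ) ω := by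
  exact AEEqFun.coeFn_sub (X : Ω →ₘ[P] ℝ) (Y : Ω →ₘ[P] ℝ)

theorem coe_smul (c : ℝ) (X : 𝒳) : ((c • X : 𝒳) : Ω →ₘ[P] ℝ) =ᵐ[P] fun ω =>
    c * (X : Ω →ₘ[P] ℝ) ω := by
  exact AEEqFun.coeFn_smul c (X : Ω →ₘ[P] ℝ)

theorem coe_zero : ((0 : 𝒳) : Ω →ₘ[P] ℝ) =ᵐ[P] fun _ => 0 := by
  exact (AEEqFun.coeFn_zero : ⇑(0 : Ω →ₘ[P] ℝ) =ᵐ[P] 0)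

theorem coe_sum_smul {ι : Type*} (s : Finset ι) (c : ι → ℝ) (X : ι → 𝒳) :
    ((∑ i ∈ s, c i • X i : 𝒳) : Ω →ₘ[P] ℝ) =ᵐ[P] fun ω =>
      ∑ i ∈ s, c i * (X i : Ω →ₘ[P] ℝ) ω := by
  classical
  induction s using Finset.induction_on with
  | empty => simpa using coe_zero (𝒳 := 𝒳)
  | insert a s ha ih =>
    rw [Finset.sum_insert ha]
    filter_upwards [coe_add (c a • X a) (∑ i ∈ s, c i • X i), coe_smul (c a) (X a), ih]
      with ω h1 h2 h3
    rw [h1, h2, h3, Finset.sum_insert ha]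

theorem coe_restrict (X : 𝒳) {A : Set Ω} (hA : MeasurableSet A) :
    (restrict X A hA : Ω →ₘ[P] ℝ) =ᵐ[P] A.indicator (X : Ω →ₘ[P] ℝ) :=
  AEEqFun.coeFn_mk _ _

theorem ext_ae {X Y : 𝒳} (h : (X : Ω →ₘ[P] ℝ) =ᵐ[P] (Y : Ω →ₘ[P] ℝ)) : X = Y :=
  Subtype.ext (AEEqFun.ext h)

theorem exists_abs (X : 𝒳) : ∃ Y : 𝒳, ((Y : Ω →ₘ[P] ℝ) =ᵐ[P] fun ω =>
    |(X : Ω →ₘ[P] ℝ) ω|) ∧ ‖Y‖ = ‖X‖ := by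
  obtain ⟨Y, hY⟩ := exists_of_abs_le X (Y := fun ω => |(X : Ω →ₘ[P] ℝ) ω|)
    (X : Ω →ₘ[P] ℝ).measurable.abs.aestronglyMeasurable (by simp)
  refine ⟨Y, hY, le_antisymm (norm_le_of_abs_le ?_) (norm_le_of_abs_le ?_)⟩ <;>
  · filter_upwards [hY] with ω h
    rw [h, abs_abs]

theorem norm_le_add_of_abs_le {X Y Z : 𝒳} (h : ∀ᵐ ω ∂P, |(X : Ω →ₘ[P] ℝ) ω| ≤
    |(Y : Ω →ₘ[P] ℝ) ω| + |(Z : Ω →ₘ[P] ℝ) ω|) : ‖X‖ ≤ ‖Y‖ + ‖Z‖ := by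
  obtain ⟨Y', hY', hYn⟩ := exists_abs Y
  obtain ⟨Z', hZ', hZn⟩ := exists_abs Z
  rw [← hYn, ← hZn]
  refine le_trans (norm_le_of_abs_le ?_) (norm_add_le' Y' Z')
  filter_upwards [h, hY', hZ', coe_add Y' Z'] with ω h1 h2 h3 h4
  rw [h4, h2, h3]
  exact h1.trans (le_abs_self _)

theorem norm_le_add_add_of_abs_le {X Y Z W : 𝒳} (h : ∀ᵐ ω ∂P, |(X : Ω →ₘ[P] ℝ) ω| ≤
    |(Y : Ω →ₘ[P] ℝ) ω| + |(Z : Ω →ₘ[P] ℝ) ω| + |(W : Ω →ₘ[P] ℝ) ω|) :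
    ‖X‖ ≤ ‖Y‖ + ‖Z‖ + ‖W‖ := by
  obtain ⟨Y', hY', hYn⟩ := exists_abs Y
  obtain ⟨Z', hZ', hZn⟩ := exists_abs Z
  have h1 : ‖X‖ ≤ ‖Y' + Z'‖ + ‖W‖ := by
    refine norm_le_add_of_abs_le ?_
    filter_upwards [h, hY', hZ', coe_add Y' Z'] with ω h1 h2 h3 h4
    rw [h4, h2, h3]
    exact h1.trans (add_le_add_left (le_abs_self _) _)
  have h2 := norm_add_le' Y' Z'
  rw [← hYn, ← hZn]
  linarith

end Basic

/-! ### Bounded variables and small indicators -/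

section Bounded

variable {Ω : Type*} [MeasurableSpace Ω] {P : Measure Ω} {𝒳 : RISpace P}

theorem identDistrib_indicator_one [IsFiniteMeasure P] {A B : Set Ω} (hA : MeasurableSet A)
    (hB : MeasurableSet B) (h : P A = P B) :
    IdentDistrib (A.indicator fun _ => (1 : ℝ)) (B.indicator fun _ => (1 : ℝ)) P P := by
  have hmA : Measurable (A.indicator fun _ => (1 : ℝ)) := measurable_const.indicator hA
  have hmB : Measurable (B.indicator fun _ => (1 : ℝ)) := measurable_const.indicator hB
  refine ⟨hmA.aemeasurable, hmB.aemeasurable, ?_⟩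
  have hc : P Aᶜ = P Bᶜ := by
    rw [measure_compl hA (measure_ne_top _ _), measure_compl hB (measure_ne_top _ _), h]
  classical
  ext E hE
  rw [Measure.map_apply hmA hE, Measure.map_apply hmB hE,
    Set.indicator_const_preimage_eq_union, Set.indicator_const_preimage_eq_union]
  split_ifs <;> simp [h, hc]

/-- If `|X| ≥ r > 0` on `D`, then indicators of sets no larger than `D` belong to the space, with
norm at most `‖X‖ / r`. -/
theorem exists_indicator_norm_le [IsFiniteMeasure P] (hP : IsNonatomic P) (X : 𝒳) {r : ℝ}
    (hr : 0 < r) {D : Set Ω} (hD : MeasurableSet D) (hXD : ∀ ω ∈ D, r ≤ |(X : Ω →ₘ[P] ℝ) ω|)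
    {A : Set Ω} (hA : MeasurableSet A) (hle : P A ≤ P D) :
    ∃ Y : 𝒳, ((Y : Ω →ₘ[P] ℝ) =ᵐ[P] A.indicator fun _ => (1 : ℝ)) ∧ ‖Y‖ ≤ r⁻¹ * ‖X‖ := by
  -- Solidity only reaches subsets of `D`; rearrangement invariance then carries the bound from `C`
  -- to `A`.
  obtain ⟨C, hCD, hC, hPC⟩ := hP.exists_subset_measure_eq hD hle
  have hbd : ∀ᵐ ω ∂P, |C.indicator (fun _ => (1 : ℝ)) ω| ≤ |((r⁻¹ • X : 𝒳) : Ω →ₘ[P] ℝ) ω| := by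
    filter_upwards [coe_smul r⁻¹ X] with ω h1
    rw [h1]
    by_cases hω : ω ∈ C
    · rw [Set.indicator_of_mem hω, abs_one, abs_mul, abs_of_pos (inv_pos.2 hr),
        inv_mul_eq_div, le_div_iff₀ hr, one_mul]
      exact hXD ω (hCD hω)
    · rw [Set.indicator_of_notMem hω, abs_zero]
      exact abs_nonneg _
  obtain ⟨Y₀, hY₀⟩ := exists_of_abs_le (r⁻¹ • X)
    (measurable_const.indicator hC).aestronglyMeasurable hbd
  have hnorm : ‖Y₀‖ ≤ r⁻¹ * ‖X‖ := by
    have h1 : ‖Y₀‖ ≤ ‖r⁻¹ • X‖ := norm_le_of_abs_le (by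
      filter_upwards [hY₀, hbd] with ω h1 h2
      rwa [h1])
    rwa [norm_smul', abs_of_pos (inv_pos.2 hr)] at h1
  have hid : IdentDistrib (A.indicator fun _ => (1 : ℝ)) (Y₀ : Ω →ₘ[P] ℝ) P P :=
    (identDistrib_indicator_one hA hC hPC.symm).trans
      (IdentDistrib.of_ae_eq (measurable_const.indicator hC).aemeasurable hY₀.symm)
  obtain ⟨Y, hY, hlaw⟩ := exists_sameLaw Y₀ hid
  exact ⟨Y, hY, (norm_eq_of_sameLaw hlaw).trans_le hnorm⟩

/-- A nonzero element is bounded below in modulus on a set `D` of positive measure. Sets no larger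
than `D` thus have indicators in the space, and repeated halving reduces `Ω` to such sets. -/
theorem exists_one [IsFiniteMeasure P] (hP : IsNonatomic P) (𝒳 : RISpace P) :
    ∃ e : 𝒳, (e : Ω →ₘ[P] ℝ) =ᵐ[P] fun _ => (1 : ℝ) := by
  obtain ⟨X, hXm, hX0⟩ := Submodule.exists_mem_ne_zero_of_ne_bot 𝒳.ne_bot
  obtain ⟨n, hn⟩ : ∃ n : ℕ, 0 < P {ω | 1 / ((n : ℝ) + 1) ≤ |X ω|} := by
    by_contra! hcon
    refine hX0 (AEEqFun.ext ?_)
    have h1 : ∀ᵐ ω ∂P, ∀ n : ℕ, ¬ 1 / ((n : ℝ) + 1) ≤ |X ω| := by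
      rw [ae_all_iff]
      intro n
      rw [ae_iff]
      simpa using hcon n
    filter_upwards [h1, AEEqFun.coeFn_zero (μ := P) (β := ℝ) (α := Ω)] with ω h2 h3
    rw [h3]
    by_contra hne
    obtain ⟨n, hn⟩ := exists_nat_one_div_lt (abs_pos.2 hne)
    exact h2 n hn.le
  set D := {ω | 1 / ((n : ℝ) + 1) ≤ |X ω|} with hDdef
  have hD : MeasurableSet D := measurableSet_le measurable_const X.measurable.abs
  have key : ∀ (m : ℕ) (A : Set Ω), MeasurableSet A → P A ≤ 2 ^ m * P D →
      ∃ Y : 𝒳, (Y : Ω →ₘ[P] ℝ) =ᵐ[P] A.indicator fun _ => (1 : ℝ) := by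
    intro m
    induction m with
    | zero =>
      intro A hA hle
      obtain ⟨Y, hY, -⟩ := exists_indicator_norm_le hP (⟨X, hXm⟩ : 𝒳)
        (Nat.one_div_pos_of_nat (α := ℝ) (n := n)) hD (fun ω hω => hω) hA (by simpa using hle)
      exact ⟨Y, hY⟩
    | succ m ih =>
      intro A hA hle
      obtain ⟨C, hCA, hC, hPC⟩ := hP.exists_subset_measure_eq hA (ENNReal.half_le_self (a := P A))
      have hhalf : P A / 2 ≤ 2 ^ m * P D := by
        rw [ENNReal.div_le_iff (by norm_num) (by norm_num)]
        calc P A ≤ 2 ^ (m + 1) * P D := hle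
          _ = 2 ^ m * P D * 2 := by rw [pow_succ]; ring
      have hdiff : P (A \ C) = P A / 2 := by
        rw [measure_sdiff hCA hC.nullMeasurableSet (measure_ne_top _ _), hPC]
        exact ENNReal.sub_half (measure_ne_top _ _)
      obtain ⟨Y₁, h₁⟩ := ih C hC (hPC.trans_le hhalf)
      obtain ⟨Y₂, h₂⟩ := ih (A \ C) (hA.diff hC) (hdiff.trans_le hhalf)
      refine ⟨Y₁ + Y₂, ?_⟩
      filter_upwards [h₁, h₂, coe_add Y₁ Y₂] with ω g₁ g₂ g₃
      rw [g₃, g₁, g₂]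
      by_cases hωC : ω ∈ C
      · simp [hωC, hCA hωC]
      · by_cases hωA : ω ∈ A <;> simp [hωC, hωA]
  obtain ⟨m, hm⟩ := ENNReal.exists_nat_gt (ENNReal.div_lt_top (measure_ne_top P Set.univ) hn.ne').ne
  have hm' : P Set.univ ≤ 2 ^ m * P D := by
    rw [← ENNReal.div_le_iff hn.ne' (measure_ne_top _ _)]
    exact hm.le.trans (by exact_mod_cast Nat.lt_two_pow_self.le)
  simpa using key m Set.univ MeasurableSet.univ hm'

theorem exists_of_bounded [IsFiniteMeasure P] (hP : IsNonatomic P) (𝒳 : RISpace P)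
    {Y : Ω → ℝ} (hY : AEStronglyMeasurable Y P) {r : ℝ} (h : ∀ᵐ ω ∂P, |Y ω| ≤ r) :
    ∃ Y' : 𝒳, (Y' : Ω →ₘ[P] ℝ) =ᵐ[P] Y := by
  obtain ⟨e, he⟩ := exists_one hP 𝒳
  refine exists_of_abs_le (r • e) hY ?_
  filter_upwards [h, he, coe_smul r e] with ω h1 h2 h3
  rw [h3, h2, mul_one]
  exact h1.trans (le_abs_self r)

/-- A space different from `L^∞` contains an unbounded random variable. -/
theorem exists_unbounded [IsFiniteMeasure P] (hP : IsNonatomic P)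
    (hne : (𝒳.toSubmodule : Set (Ω →ₘ[P] ℝ)) ≠ (Lp ℝ ∞ P : Set (Ω →ₘ[P] ℝ))) :
    ∃ X : 𝒳, ∀ r : ℝ, 0 < P {ω | r ≤ |(X : Ω →ₘ[P] ℝ) ω|} := by
  by_contra! hcon
  refine hne (Set.Subset.antisymm ?_ ?_)
  · intro X hX
    obtain ⟨r, hr⟩ := hcon ⟨X, hX⟩
    rw [SetLike.mem_coe, Lp.mem_Lp_iff_memLp]
    refine memLp_top_of_bound X.aestronglyMeasurable r ?_
    have h1 : ∀ᵐ ω ∂P, ¬ r ≤ |X ω| := by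
      rw [ae_iff]
      simpa using hr
    filter_upwards [h1] with ω h2
    rw [Real.norm_eq_abs]
    exact (not_le.1 h2).le
  · intro X hX
    rw [SetLike.mem_coe, Lp.mem_Lp_iff_memLp] at hX
    obtain ⟨Y, hY⟩ := exists_of_bounded hP 𝒳 X.aestronglyMeasurable
      (r := (eLpNormEssSup X P).toReal) (by
        have hfin : eLpNormEssSup X P ≠ ∞ := by
          rw [← eLpNorm_exponent_top]; exact hX.2.ne
        filter_upwards [ae_le_eLpNormEssSup (f := X) (μ := P)] with ω h1
        have := ENNReal.toReal_mono hfin h1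
        simpa using this)
    rw [← AEEqFun.ext hY]
    exact Y.2

/-- The point where `𝒳 ≠ L^∞` enters: an unbounded `X` exceeds any level `r` on a set of positive
measure, and indicators of smaller sets have norm at most `‖X‖ / r`. -/
theorem exists_indicator_norm_lt [IsFiniteMeasure P] (hP : IsNonatomic P)
    (hne : (𝒳.toSubmodule : Set (Ω →ₘ[P] ℝ)) ≠ (Lp ℝ ∞ P : Set (Ω →ₘ[P] ℝ)))
    {ε : ℝ} (hε : 0 < ε) :
    ∃ δ : ℝ≥0∞, 0 < δ ∧ ∀ A : Set Ω, MeasurableSet A → P A < δ →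
      ∃ Y : 𝒳, ((Y : Ω →ₘ[P] ℝ) =ᵐ[P] A.indicator fun _ => (1 : ℝ)) ∧ ‖Y‖ < ε := by
  obtain ⟨X, hX⟩ := exists_unbounded hP hne
  have hr : 0 < (‖X‖ + 1) / ε := div_pos (by linarith [norm_nonneg' X]) hε
  refine ⟨_, hX ((‖X‖ + 1) / ε), fun A hA hlt => ?_⟩
  obtain ⟨Y, hY, hn⟩ := exists_indicator_norm_le hP X hr
    (measurableSet_le measurable_const (X : Ω →ₘ[P] ℝ).measurable.abs) (fun ω hω => hω) hA hlt.le
  refine ⟨Y, hY, hn.trans_lt ?_⟩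
  rw [inv_div, div_mul_eq_mul_div, div_lt_iff₀ (by linarith [norm_nonneg' X])]
  nlinarith

theorem mem_orderContinuousPart_of_bounded [IsFiniteMeasure P] (hP : IsNonatomic P)
    (hne : (𝒳.toSubmodule : Set (Ω →ₘ[P] ℝ)) ≠ (Lp ℝ ∞ P : Set (Ω →ₘ[P] ℝ)))
    {V : 𝒳} {r : ℝ} (h : ∀ᵐ ω ∂P, |(V : Ω →ₘ[P] ℝ) ω| ≤ r) : V ∈ 𝒳.orderContinuousPart := by
  intro ε hε
  have hr : 0 < |r| + 1 := by positivity
  obtain ⟨δ, hδ, hsmall⟩ := exists_indicator_norm_lt hP hne (div_pos hε hr)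
  refine ⟨δ, hδ, fun A hA hlt => ?_⟩
  obtain ⟨Y, hY, hn⟩ := hsmall A hA hlt
  have h1 : ‖restrict V A hA‖ ≤ ‖(|r| + 1) • Y‖ := by
    refine norm_le_of_abs_le ?_
    filter_upwards [h, hY, coe_restrict V hA, coe_smul (|r| + 1) Y] with ω h1 h2 h3 h4
    rw [h3, h4, h2]
    by_cases hω : ω ∈ A
    · simp only [Set.indicator_of_mem hω, mul_one]
      rw [abs_of_pos hr]
      linarith [le_abs_self r]
    · simp [hω]
  rw [norm_smul', abs_of_pos hr] at h1
  rw [lt_div_iff₀ hr] at hn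
  linarith

end Bounded

end RISpace

/-! ### Small averages, extensions and distances -/

namespace RISpace

section Averages

variable {Ω : Type*} [MeasurableSpace Ω] {P : Measure Ω} {𝒳 : RISpace P}

/-- A convex combination of copies of `|X| 𝟏_{D i}` that is close to the order continuous part
yields small convex combinations of copies of `X 𝟏_{A m}`, carried by any given set, as soon as
the sets `A m ⊆ D i` shrink to `∅`. -/
theorem exists_small_average_of_dominating [IsFiniteMeasure P] (hP : IsNonatomic P)
    (hne : (𝒳.toSubmodule : Set (Ω →ₘ[P] ℝ)) ≠ (Lp ℝ ∞ P : Set (Ω →ₘ[P] ℝ)))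
    (X : 𝒳) {B : Set Ω} (hB : MeasurableSet B) (hB0 : 0 < P B)
    {A : ℕ → Set Ω} (hA : ∀ n, MeasurableSet (A n)) (hAanti : Antitone A)
    (hAinter : ⋂ n, A n = ∅) {k : ℕ} {c : Fin k → ℝ} (hc0 : ∀ i, 0 ≤ c i)
    (hc1 : ∑ i, c i = 1) {W : Fin k → 𝒳} {D : Fin k → Set Ω} (N : ℕ)
    (hAD : ∀ i, ∀ m, N ≤ m → A m ⊆ D i)
    (hW : ∀ i, IdentDistrib (W i : Ω →ₘ[P] ℝ)
      ((D i).indicator fun ω => |(X : Ω →ₘ[P] ℝ) ω|) P P)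
    {V : 𝒳} (hV : V ∈ 𝒳.orderContinuousPart) {ε : ℝ} (hlt : ‖(∑ i, c i • W i) - V‖ < ε) :
    ∃ (m : ℕ) (Z : Fin k → 𝒳), (∀ i, SameLaw (Z i) (restrict X (A m) (hA m))) ∧
      (∀ i, SupportedIn (Z i) B) ∧ ‖∑ i, c i • Z i‖ < ε := by
  let X' : Ω → ℝ := fun ω => (X : Ω →ₘ[P] ℝ) ω
  have hXm : Measurable X' := (X : Ω →ₘ[P] ℝ).measurable
  have hWm : ∀ i, Measurable (W i : Ω →ₘ[P] ℝ) := fun i => (W i : Ω →ₘ[P] ℝ).measurable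
  have hW0 : ∀ i, ∀ᵐ ω ∂P, 0 ≤ (W i : Ω →ₘ[P] ℝ) ω := fun i =>
    (hW i).symm.ae_snd (p := fun x => 0 ≤ x) measurableSet_Ici
      (Filter.Eventually.of_forall fun ω => Set.indicator_nonneg (fun _ _ => abs_nonneg _) ω)
  -- Half of the slack each for `V 𝟏_S` and `𝟏_S`.
  set η := (ε - ‖(∑ i, c i • W i) - V‖) / 2 with hη
  have hη0 : 0 < η := by linarith
  obtain ⟨δ₁, hδ₁, hV'⟩ := hV η hη0
  obtain ⟨δ₂, hδ₂, hone⟩ := exists_indicator_norm_lt hP hne hη0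
  have htend : Filter.Tendsto (fun n => (k : ℝ≥0∞) * P (A n)) Filter.atTop (nhds 0) := by
    have h1 := tendsto_measure_iInter_atTop (μ := P) (fun n => (hA n).nullMeasurableSet) hAanti
      ⟨0, measure_ne_top _ _⟩
    rw [hAinter, measure_empty] at h1
    simpa using ENNReal.Tendsto.const_mul h1 (Or.inr (ENNReal.natCast_ne_top k))
  obtain ⟨m, hm, hmN⟩ := ((htend.eventually_lt_const
    (lt_min (lt_min hδ₁ hδ₂) hB0)).and (Filter.eventually_ge_atTop N)).exists
  have hYm : Measurable ((A m).indicator X') := hXm.indicator (hA m)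
  have hcopy : ∀ i, ∃ z : Ω → ℝ, Measurable z ∧ P.map z = P.map ((A m).indicator X') ∧
      ∀ᵐ ω ∂P, |z ω| ≤ |(W i : Ω →ₘ[P] ℝ) ω| + 1 := by
    intro i
    -- Cutting down to `A m ⊆ D i` can only shrink the nonzero levels, while level `0` may grow;
    -- hence the exclusion of `j = 0`.
    refine hP.exists_map_eq_abs_le_add_one hYm (hWm i) fun j hj => ?_
    have hlev : MeasurableSet {x : ℝ | ⌊|x|⌋₊ = j} :=
      measurable_natFloor_abs (measurableSet_singleton j)
    have h1 : P {ω | ⌊|(W i : Ω →ₘ[P] ℝ) ω|⌋₊ = j} =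
        P {ω | ⌊|(D i).indicator (fun ω => |X' ω|) ω|⌋₊ = j} := (hW i).measure_mem_eq hlev
    rw [h1]
    refine measure_mono fun ω hω => ?_
    by_cases hωA : ω ∈ A m
    · have := hAD i m hmN hωA
      simpa [hωA, this] using hω
    · simp only [Set.mem_ofPred_eq, Set.indicator_of_notMem hωA, abs_zero, Nat.floor_zero] at hω
      exact absurd hω.symm hj
  choose z hz hzmap hzW using hcopy
  let S : Set Ω := ⋃ i, {ω | z i ω ≠ 0}
  have hS : MeasurableSet S :=
    MeasurableSet.iUnion fun i => (hz i (measurableSet_singleton 0)).compl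
  have hzA : ∀ i, P {ω | z i ω ≠ 0} ≤ P (A m) := by
    intro i
    have h1 := congrArg (fun μ : Measure ℝ => μ {0}ᶜ) (hzmap i)
    have h0 : MeasurableSet ({0}ᶜ : Set ℝ) := (measurableSet_singleton 0).compl
    simp only [Measure.map_apply (hz i) h0, Measure.map_apply hYm h0] at h1
    refine (h1.trans_le (measure_mono fun ω hω => ?_) : P (z i ⁻¹' {0}ᶜ) ≤ _)
    by_contra hωA
    simp [hωA] at hω
  have hPS : P S ≤ k * P (A m) := by
    calc P S ≤ ∑ i, P {ω | z i ω ≠ 0} := measure_iUnion_fintype_le _ _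
      _ ≤ ∑ _i : Fin k, P (A m) := Finset.sum_le_sum fun i _ => hzA i
      _ = k * P (A m) := by simp
  have hPS' := hPS.trans_lt hm
  simp only [lt_min_iff] at hPS'
  -- the average of the copies before moving them into `B`
  have hident : ∀ {u : Ω → ℝ}, Measurable u → P.map u = P.map ((A m).indicator X') →
      IdentDistrib u (restrict X (A m) (hA m) : Ω →ₘ[P] ℝ) P P := fun hu h =>
    (⟨hu.aemeasurable, hYm.aemeasurable, h⟩ : IdentDistrib _ ((A m).indicator X') P P).trans
      (IdentDistrib.of_ae_eq hYm.aemeasurable (coe_restrict X (hA m)).symm)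
  choose z' hz' hz'law using fun i => exists_sameLaw _ (hident (hz i) (hzmap i))
  have hsmall : ‖∑ i, c i • z' i‖ < ε := by
    obtain ⟨E, hE, hEn⟩ := hone S hS hPS'.1.2
    have hVn := hV' S hS hPS'.1.1
    have h1 : ‖∑ i, c i • z' i‖ ≤ ‖(∑ i, c i • W i) - V‖ + ‖restrict V S hS‖ + ‖E‖ := by
      refine norm_le_add_add_of_abs_le ?_
      filter_upwards [coe_sum_smul Finset.univ c z', coe_sum_smul Finset.univ c W,
        coe_sub (∑ i, c i • W i) V, coe_restrict V hS, hE, ae_all_iff.2 hz', ae_all_iff.2 hzW,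
        ae_all_iff.2 hW0] with ω e1 e2 e3 e4 e5 e6 e7 e8
      rw [e1, e3, e2, e4, e5]
      simp only [e6]
      by_cases hω : ω ∈ S
      · rw [Set.indicator_of_mem hω, Set.indicator_of_mem hω, abs_one]
        have h2 : |∑ i, c i * z i ω| ≤ ∑ i, c i * (W i : Ω →ₘ[P] ℝ) ω + 1 := by
          calc |∑ i, c i * z i ω| ≤ ∑ i, |c i * z i ω| := Finset.abs_sum_le_sum_abs _ _
            _ ≤ ∑ i, (c i * (W i : Ω →ₘ[P] ℝ) ω + c i) := by
              refine Finset.sum_le_sum fun i _ => ?_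
              rw [abs_mul, abs_of_nonneg (hc0 i), ← mul_add_one]
              refine mul_le_mul_of_nonneg_left ?_ (hc0 i)
              have := e7 i
              rwa [abs_of_nonneg (e8 i)] at this
            _ = ∑ i, c i * (W i : Ω →ₘ[P] ℝ) ω + 1 := by rw [Finset.sum_add_distrib, hc1]
        have h3 := le_abs_self (∑ i, c i * (W i : Ω →ₘ[P] ℝ) ω - (V : Ω →ₘ[P] ℝ) ω)
        have h4 := le_abs_self ((V : Ω →ₘ[P] ℝ) ω)
        linarith
      · have h2 : ∀ i, z i ω = 0 := by
          intro i
          by_contra hne0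
          exact hω (Set.mem_iUnion.2 ⟨i, hne0⟩)
        simp only [h2, mul_zero, Finset.sum_const_zero, abs_zero]
        positivity
    linarith
  -- The copies move into `B` as one vector: the joint law, unlike the separate laws, determines the
  -- norm of the average.
  let zv : Ω → Fin k → ℝ := fun ω i => z i ω
  have hzv : Measurable zv := measurable_pi_iff.2 hz
  have hzvS : {ω | zv ω ≠ 0} = S := by
    ext ω
    simp [zv, S, funext_iff]
  obtain ⟨w, hw, hwmap, hwB⟩ := hP.exists_map_eq_supported hzv hB (by
    rw [hzvS]; exact hPS'.2.le)
  have hwi : ∀ i, Measurable fun ω => w ω i := fun i => (measurable_pi_apply i).comp hw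
  have hwid : IdentDistrib w zv P P := ⟨hw.aemeasurable, hzv.aemeasurable, hwmap⟩
  have hwz : ∀ i, P.map (fun ω => w ω i) = P.map ((A m).indicator X') := fun i =>
    (hwid.comp (measurable_pi_apply i)).map_eq.trans (hzmap i)
  choose w' hw' hw'law using fun i => exists_sameLaw _ (hident (hwi i) (hwz i))
  refine ⟨m, w', hw'law, fun i => ?_, ?_⟩
  · filter_upwards [hw' i, hwB] with ω h1 h2 hωB
    rw [h1, h2 hωB, Pi.zero_apply]
  · have hlin : Measurable fun x : Fin k → ℝ => ∑ i, c i * x i := by fun_prop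
    have h1 : SameLaw (∑ i, c i • w' i) (∑ i, c i • z' i) := by
      have e1 : (fun ω => ∑ i, c i * w ω i) =ᵐ[P] ((∑ i, c i • w' i : 𝒳) : Ω →ₘ[P] ℝ) := by
        filter_upwards [coe_sum_smul Finset.univ c w', ae_all_iff.2 hw'] with ω h1 h2
        rw [h1]
        simp only [h2]
      have e2 : (fun ω => ∑ i, c i * zv ω i) =ᵐ[P] ((∑ i, c i • z' i : 𝒳) : Ω →ₘ[P] ℝ) := by
        filter_upwards [coe_sum_smul Finset.univ c z', ae_all_iff.2 hz'] with ω h1 h2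
        rw [h1]
        simp only [h2, zv]
      exact (IdentDistrib.of_ae_eq (hlin.comp hw).aemeasurable e1).symm.trans
        ((hwid.comp hlin).trans (IdentDistrib.of_ae_eq (hlin.comp hzv).aemeasurable e2))
    rw [norm_eq_of_sameLaw h1]
    exact hsmall

/-- Copies of `X 𝟏_{|X| > r}` carried by `A` extend to copies of `X` carried by `A`, up to a
bounded error. -/
theorem exists_bounded_extension [IsFiniteMeasure P] (hP : IsNonatomic P) {X Z : 𝒳}
    {A T : Set Ω} (hA : MeasurableSet A) (hT : MeasurableSet T) {r : ℝ} (hr : 0 ≤ r)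
    (hTr : T = {ω | r < |(X : Ω →ₘ[P] ℝ) ω|}) (hX : SupportedIn X A) (hZ : SupportedIn Z A)
    (hlaw : SameLaw Z (restrict X T hT)) :
    ∃ U : 𝒳, (∀ᵐ ω ∂P, |(U : Ω →ₘ[P] ℝ) ω| ≤ r) ∧ SupportedIn U A ∧
      SameLaw (Z + U) X ∧ SupportedIn (Z + U) A := by
  subst hTr
  have hXm := (X : Ω →ₘ[P] ℝ).measurable
  obtain ⟨u, hu, hur, huA, hulaw⟩ := hP.exists_bounded_extension hXm
    (Z : Ω →ₘ[P] ℝ).measurable hA hX hr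
    (hlaw.map_eq.trans (Measure.map_congr (coe_restrict X hT)))
  obtain ⟨U, hU⟩ := exists_of_bounded hP 𝒳 hu.aestronglyMeasurable hur
  refine ⟨U, ?_, ?_, ?_, ?_⟩
  · filter_upwards [hU, hur] with ω h1 h2
    rwa [h1]
  · filter_upwards [hU, huA] with ω h1 h2
    rwa [h1]
  · have h1 : ((Z + U : 𝒳) : Ω →ₘ[P] ℝ) =ᵐ[P] fun ω => (Z : Ω →ₘ[P] ℝ) ω + u ω := by
      filter_upwards [coe_add Z U, hU] with ω h1 h2
      rw [h1, h2]
    exact ⟨AEEqFun.aemeasurable _, AEEqFun.aemeasurable _, (Measure.map_congr h1).trans hulaw⟩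
  · filter_upwards [coe_add Z U, hU, huA, hZ] with ω h1 h2 h3 h4 hω
    rw [h1, h2, h3 hω, h4 hω, add_zero]

/-- Nonemptiness matters because the real infimum of the empty set is `0`. -/
theorem setDist_lt_iff {S T : Set 𝒳} (hS : S.Nonempty) (hT : T.Nonempty) {ε : ℝ} :
    setDist S T < ε ↔ ∃ X ∈ S, ∃ Y ∈ T, ‖X - Y‖ < ε := by
  rw [setDist, csInf_lt_iff ⟨0, ?_⟩ (hS.image2 hT)]
  · constructor
    · rintro ⟨_, ⟨X, hX, Y, hY, rfl⟩, h⟩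
      exact ⟨X, hX, Y, hY, h⟩
    · rintro ⟨X, hX, Y, hY, h⟩
      exact ⟨_, ⟨X, hX, Y, hY, rfl⟩, h⟩
  · rintro _ ⟨X, -, Y, -, rfl⟩
    exact norm_nonneg' _

theorem setDist_nonneg (S T : Set 𝒳) : 0 ≤ setDist S T :=
  Real.sInf_nonneg (by
    rintro _ ⟨X, -, Y, -, rfl⟩
    exact norm_nonneg' _)

theorem sameLaw_refl (X : 𝒳) : SameLaw X X := IdentDistrib.refl (AEEqFun.aemeasurable _)

theorem CL_nonempty (X : 𝒳) : (CL X).Nonempty :=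
  ⟨X, subset_convexHull ℝ _ (sameLaw_refl X)⟩

theorem zero_mem_orderContinuousPart : (0 : 𝒳) ∈ 𝒳.orderContinuousPart := by
  intro ε hε
  refine ⟨1, one_pos, fun A hA _ => ?_⟩
  have h1 : restrict (0 : 𝒳) A hA = 0 := ext_ae (by
    filter_upwards [coe_restrict (0 : 𝒳) hA, coe_zero (𝒳 := 𝒳)] with ω h1 h2
    rw [h1, h2]
    exact Set.indicator_apply_eq_zero.2 fun _ => h2)
  rwa [h1, norm_zero']

theorem mem_CL_iff {X Y : 𝒳} : Y ∈ CL X ↔ ∃ (k : ℕ) (W : Fin k → 𝒳) (c : Fin k → ℝ),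
    (∀ i, SameLaw (W i) X) ∧ (∀ i, 0 ≤ c i) ∧ (∑ i, c i) = 1 ∧ ∑ i, c i • W i = Y := by
  constructor
  · intro h
    obtain ⟨ι, _, c, W, hc0, hc1, hW, hsum⟩ := mem_convexHull_iff_exists_fintype.1 h
    let e := (Fintype.equivFin ι).symm
    refine ⟨Fintype.card ι, W ∘ e, c ∘ e, fun i => hW _, fun i => hc0 _, ?_, ?_⟩
    · rw [← hc1]; exact e.sum_comp c
    · rw [← hsum]; exact e.sum_comp fun i => c i • W i
  · rintro ⟨k, W, c, hW, hc0, hc1, hsum⟩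
    exact mem_convexHull_of_exists_fintype c W hc0 hc1 hW hsum

end Averages

end RISpace

/-! ### The equivalences -/

theorem proposition2p3 {Ω : Type*} [MeasurableSpace Ω] (P : Measure Ω) [IsProbabilityMeasure P]
    (hP : IsNonatomic P) (𝒳 : RISpace P)
    (hne : (𝒳.toSubmodule : Set (Ω →ₘ[P] ℝ)) ≠ (Lp ℝ ∞ P : Set (Ω →ₘ[P] ℝ))) :
    List.TFAE [
      𝒳.AOCEA,
      ∀ (A : Set Ω), MeasurableSet A → 0 < P A →
        ∀ X : 𝒳, RISpace.SupportedIn X A → ∀ ε : ℝ, 0 < ε →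
        ∃ (k : ℕ) (Y : Fin k → 𝒳) (c : Fin k → ℝ) (V : 𝒳),
          (∀ i, RISpace.SupportedIn (Y i) A) ∧ (∀ i, RISpace.SameLaw (Y i) X) ∧
          (∀ i, 0 ≤ c i) ∧ (∑ i, c i) = 1 ∧
          V ∈ 𝒳.orderContinuousPart ∧ RISpace.SupportedIn V A ∧
          ‖(∑ i, c i • Y i) - V‖ < ε,
      ∀ X : 𝒳, 0 ≤ (X : Ω →ₘ[P] ℝ) →
        ∀ (A : ℕ → Set Ω) (hA : ∀ n, MeasurableSet (A n)), Antitone A → (⋂ n, A n) = ∅ →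
        ∀ ε : ℝ, 0 < ε →
        ∃ (k : ℕ) (n : Fin k → ℕ) (Z : Fin k → 𝒳) (c : Fin k → ℝ),
          (∀ i, RISpace.SameLaw (Z i) (RISpace.restrict X (A (n i)) (hA (n i)))) ∧
          (∀ i, 0 ≤ c i) ∧ (∑ i, c i) = 1 ∧
          ‖∑ i, c i • Z i‖ < ε,
      ∀ (X : 𝒳) (B : Set Ω), MeasurableSet B → 0 < P B →
        ∀ (A : ℕ → Set Ω) (hA : ∀ n, MeasurableSet (A n)), Antitone A → (⋂ n, A n) = ∅ →
        ∀ ε : ℝ, 0 < ε →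
        ∃ (k : ℕ) (n : Fin k → ℕ) (Z : Fin k → 𝒳) (c : Fin k → ℝ),
          (∀ i, RISpace.SameLaw (Z i) (RISpace.restrict X (A (n i)) (hA (n i)))) ∧
          (∀ i, RISpace.SupportedIn (Z i) B) ∧
          (∀ i, 0 ≤ c i) ∧ (∑ i, c i) = 1 ∧
          ‖∑ i, c i • Z i‖ < ε] := by
  tfae_have 1 → 4 := by
    intro h X B hB hB0 A hA hanti hinter ε hε
    -- The AOCEA property speaks of nonnegative variables only, so it is applied to `|X|`, whose
    -- copies dominate the signed ones.
    obtain ⟨Y, hY, -⟩ := RISpace.exists_abs X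
    have hY0 : 0 ≤ (Y : Ω →ₘ[P] ℝ) := by
      rw [← AEEqFun.coeFn_le]
      filter_upwards [hY, AEEqFun.coeFn_zero (μ := P) (β := ℝ) (α := Ω)] with ω h1 h2
      rw [h1, h2]
      exact abs_nonneg _
    obtain ⟨C, hC, V, hV, hlt⟩ := (RISpace.setDist_lt_iff (RISpace.CL_nonempty Y)
      ⟨0, RISpace.zero_mem_orderContinuousPart⟩).1 ((h Y hY0).trans_lt hε)
    obtain ⟨k, W, c, hW, hc0, hc1, rfl⟩ := RISpace.mem_CL_iff.1 hC
    obtain ⟨m, Z, hZ, hZB, hZn⟩ := RISpace.exists_small_average_of_dominating hP hne X hB hB0 hA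
      hanti hinter hc0 hc1 (W := W) (D := fun _ => Set.univ) 0 (fun _ _ _ => Set.subset_univ _)
      (fun i => (hW i).trans (by
        rw [Set.indicator_univ]
        exact IdentDistrib.of_ae_eq (AEEqFun.aemeasurable _) hY)) hV hlt
    exact ⟨k, fun _ => m, Z, c, hZ, hZB, hc0, hc1, hZn⟩
  tfae_have 4 → 3 := by
    intro h X _ A hA hanti hinter ε hε
    obtain ⟨k, n, Z, c, hZ, -, hc0, hc1, hn⟩ := h X Set.univ MeasurableSet.univ (by simp) A hA
      hanti hinter ε hε
    exact ⟨k, n, Z, c, hZ, hc0, hc1, hn⟩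
  tfae_have 3 → 4 := by
    intro h X B hB hB0 A hA hanti hinter ε hε
    obtain ⟨Y, hY, -⟩ := RISpace.exists_abs X
    have hY0 : 0 ≤ (Y : Ω →ₘ[P] ℝ) := by
      rw [← AEEqFun.coeFn_le]
      filter_upwards [hY, AEEqFun.coeFn_zero (μ := P) (β := ℝ) (α := Ω)] with ω h1 h2
      rw [h1, h2]
      exact abs_nonneg _
    obtain ⟨k, n, W, c, hW, hc0, hc1, hn⟩ := h Y hY0 A hA hanti hinter ε hε
    -- Beyond the largest `n i`, the set `A m` lies in every `A (n i)`; a small average is one close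
    -- to `V = 0`.
    obtain ⟨m, Z, hZ, hZB, hZn⟩ := RISpace.exists_small_average_of_dominating hP hne X hB hB0 hA
      hanti hinter hc0 hc1 (W := W) (D := fun i => A (n i)) (Finset.univ.sup n)
      (fun i m hm => hanti ((Finset.le_sup (Finset.mem_univ i)).trans hm))
      (fun i => (hW i).trans (IdentDistrib.of_ae_eq (AEEqFun.aemeasurable _) (by
        filter_upwards [RISpace.coe_restrict Y (hA (n i)), hY] with ω h1 h2
        rw [h1]
        by_cases hω : ω ∈ A (n i) <;> simp [hω, h2])))
      RISpace.zero_mem_orderContinuousPart (by rwa [sub_zero])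
    exact ⟨k, fun _ => m, Z, c, hZ, hZB, hc0, hc1, hZn⟩
  tfae_have 4 → 2 := by
    intro h A hA hA0 X hXA ε hε
    have hXm := (X : Ω →ₘ[P] ℝ).measurable
    have hT : ∀ n : ℕ, MeasurableSet {ω | (n : ℝ) < |(X : Ω →ₘ[P] ℝ) ω|} := fun n =>
      measurableSet_lt measurable_const hXm.abs
    -- The tail sets decrease to `∅` because `X` is finite everywhere.
    obtain ⟨k, n, Z, c, hZ, hZA, hc0, hc1, hn⟩ := h X A hA hA0 _ hT
      (fun a b hab ω hω => by
        have h1 : (a : ℝ) ≤ b := Nat.cast_le.2 hab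
        exact h1.trans_lt hω)
      (by
        rw [Set.eq_empty_iff_forall_notMem]
        intro ω hω
        obtain ⟨N, hN⟩ := exists_nat_gt |(X : Ω →ₘ[P] ℝ) ω|
        exact lt_asymm hN (Set.mem_iInter.1 hω N)) ε hε
    choose U hUr hUA hlaw hsupp using fun i => RISpace.exists_bounded_extension hP hA (hT (n i))
      (Nat.cast_nonneg (n i)) rfl hXA (hZA i) (hZ i)
    -- Subtracting the averaged corrections leaves exactly the small average of the tails.
    refine ⟨k, fun i => Z i + U i, c, ∑ i, c i • U i, hsupp, hlaw, hc0, hc1, ?_, ?_, ?_⟩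
    · refine RISpace.mem_orderContinuousPart_of_bounded hP hne (r := ∑ i, c i * n i) ?_
      filter_upwards [RISpace.coe_sum_smul Finset.univ c U, ae_all_iff.2 hUr] with ω h1 h2
      rw [h1]
      refine (Finset.abs_sum_le_sum_abs _ _).trans (Finset.sum_le_sum fun i _ => ?_)
      rw [abs_mul, abs_of_nonneg (hc0 i)]
      exact mul_le_mul_of_nonneg_left (h2 i) (hc0 i)
    · filter_upwards [RISpace.coe_sum_smul Finset.univ c U, ae_all_iff.2 hUA] with ω h1 h2 hω
      rw [h1]
      exact Finset.sum_eq_zero fun i _ => by rw [h2 i hω, mul_zero]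
    · have : (∑ i, c i • (Z i + U i)) - ∑ i, c i • U i = ∑ i, c i • Z i := by
        simp only [smul_add, Finset.sum_add_distrib, add_sub_cancel_right]
      rwa [this]
  tfae_have 2 → 1 := by
    intro h X _
    refine le_antisymm (le_of_forall_gt fun ε hε => ?_) (RISpace.setDist_nonneg _ _)
    obtain ⟨k, Y, c, V, -, hY, hc0, hc1, hV, -, hlt⟩ := h Set.univ MeasurableSet.univ (by simp) X
      (Filter.Eventually.of_forall fun ω hω => absurd (Set.mem_univ ω) hω) ε hε
    exact (RISpace.setDist_lt_iff (RISpace.CL_nonempty X)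
      ⟨0, RISpace.zero_mem_orderContinuousPart⟩).2
      ⟨_, RISpace.mem_CL_iff.2 ⟨k, Y, c, hY, hc0, hc1, rfl⟩, V, hV, hlt⟩
  tfae_finish
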